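/- Let $p$ be a prime, let $K$ be a finite extension of $\mathbb{Q}_p$ with algebraic closure $\bar K$ and absolute Galois group $G_K$, and let $|\cdot|$ be the extension to $K$ of the $p$-adic absolute value. For a polynomial $g\in K[t]$ with set of roots $R\subset\bar K$ put \[ w_K(g)=\sum_{r\in R/G_K} m(r)\cdot\bigl(v_K(\Delta_{K(r)/K})-[K(r):K]+f_{K(r)/K}\bigr), \] where $m(r)$ is the multiplicity of $r$ as a root of $g$, $\Delta_{K(r)/K}$ is the discriminant ideal, $f_{K(r)/K}$ is the residue degree, and $v_K$ is the normalised valuation of $K$. Let $g\in K[t]$ be $p$-th-power-free, i.e. every $q\in K[t]$ with $q^p\mid g$ is a non-zero constant. Then there is $\varepsilon>0$ such that every square-free $h\in K[t]$ with $\deg h<\deg g+p$, all of whose coefficients satisfy $|h_i-g_i|<\varepsilon$, has \[ w_K(h)=w_K(g). \] (In particular this holds for every square-free $h$ of the same degree as $g$ whose coefficients are sufficiently close to those of $g$.) -/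

import Mathlib

open Polynomial IntermediateField

namespace WildExponent

/-- The `p`-adic absolute value of an algebraic extension `L` of `ℚ_p`, that is, the unique
extension to `L` of the absolute value of `ℚ_p` (Mathlib's spectral norm), as a valuation. -/
noncomputable def padicAbs (p : ℕ) [Fact p.Prime] (L : Type*) [Field L] [Algebra ℚ_[p] L]
    [Algebra.IsAlgebraic ℚ_[p] L] : Valuation L NNReal where
  toFun x := ⟨spectralNorm ℚ_[p] L x, spectralNorm_nonneg x⟩
  map_zero' := Subtype.ext spectralNorm_zero
  map_one' := Subtype.ext spectralNorm_one
  map_mul' x y := Subtype.ext (map_mul (spectralMulAlgNorm ℚ_[p] L) x y)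
  map_add_le_max' x y := isNonarchimedean_spectralNorm x y

/-- The absolute value on `L` extends the one on a subextension `K`. -/
instance padicAbs_hasExtension (p : ℕ) [Fact p.Prime] (K L : Type*) [Field K] [Field L]
    [Algebra ℚ_[p] K] [Algebra ℚ_[p] L] [Algebra K L] [IsScalarTower ℚ_[p] K L]
    [Algebra.IsAlgebraic ℚ_[p] K] [Algebra.IsAlgebraic ℚ_[p] L] :
    (padicAbs p K).HasExtension (padicAbs p L) where
  val_isEquiv_comap := by
    have h : padicAbs p K = (padicAbs p L).comap (algebraMap K L) := by
      ext x
      change spectralNorm ℚ_[p] K x = spectralNorm ℚ_[p] L (algebraMap K L x)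
      unfold spectralNorm
      rw [minpoly.algebraMap_eq (algebraMap K L).injective]
    rw [← h]
    exact Valuation.IsEquiv.refl

/-- The ring of integers of an algebraic extension `L` of `ℚ_p`. -/
noncomputable abbrev ringOfInt (p : ℕ) [Fact p.Prime] (L : Type*) [Field L] [Algebra ℚ_[p] L]
    [Algebra.IsAlgebraic ℚ_[p] L] : ValuationSubring L :=
  (padicAbs p L).valuationSubring

section Extension

variable (p : ℕ) [Fact p.Prime] (K L : Type*) [Field K] [Field L]
  [Algebra ℚ_[p] K] [Algebra ℚ_[p] L] [Algebra K L] [IsScalarTower ℚ_[p] K L]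
  [Algebra.IsAlgebraic ℚ_[p] K] [Algebra.IsAlgebraic ℚ_[p] L]

/-- The discriminant `Δ_{L/K}`: the ideal of the ring of integers of `K` generated by the
discriminants of all `K`-bases of `L` that consist of integral elements. -/
noncomputable def discIdeal : Ideal (ringOfInt p K) :=
  Ideal.span {d | ∃ b : Module.Basis (Fin (Module.finrank K L)) K L,
    (∀ i, b i ∈ ringOfInt p L) ∧ (d : K) = Algebra.discr K b}

/-- `v_K(Δ_{L/K})`: the exponent of the maximal ideal of the ring of integers of `K` in the
discriminant `Δ_{L/K}`. -/
noncomputable def discExponent : ℕ :=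
  multiplicity (IsLocalRing.maximalIdeal (ringOfInt p K)) (discIdeal p K L)

/-- The residue degree `f_{L/K}`. -/
noncomputable def residueDegree : ℕ :=
  Module.finrank (IsLocalRing.ResidueField (ringOfInt p K))
    (IsLocalRing.ResidueField (ringOfInt p L))

end Extension

section Exponent

variable (p : ℕ) [Fact p.Prime] (K : Type*) [Field K] [Algebra ℚ_[p] K]
  [FiniteDimensional ℚ_[p] K]

/-- Subextensions of the algebraic closure of `K` are algebraic over `ℚ_p`. -/
instance isAlgebraic_intermediateField (E : IntermediateField K (AlgebraicClosure K)) :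
    Algebra.IsAlgebraic ℚ_[p] E :=
  Algebra.IsAlgebraic.trans ℚ_[p] K E

/-- `v_K(Δ_{K(r)/K}) - [K(r) : K] + f_{K(r)/K}`. -/
noncomputable def rootTerm (r : AlgebraicClosure K) : ℤ :=
  (discExponent p K K⟮r⟯ : ℤ) - (Module.finrank K K⟮r⟯ : ℤ) + (residueDegree p K K⟮r⟯ : ℤ)

/-- `R / G_K`, the orbits of the absolute Galois group of `K` on the set `R` of roots of `g` in
the algebraic closure of `K`. -/
def rootOrbits {K : Type*} [Field K] (g : K[X]) :
    Set (MulAction.orbitRel.Quotient (AlgebraicClosure K ≃ₐ[K] AlgebraicClosure K)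
      (AlgebraicClosure K)) :=
  (fun r => Quotient.mk _ r) '' g.rootSet (AlgebraicClosure K)

/-- `w_K(g)`: the sum over the Galois orbits of roots `r` of `g` of
`m(r) * (v_K(Δ_{K(r)/K}) - [K(r) : K] + f_{K(r)/K})`, where `m(r)` is the multiplicity of `r`.
Each summand is evaluated at a representative of the orbit. -/
noncomputable def wildExponent (g : K[X]) : ℤ :=
  ∑ᶠ ω ∈ rootOrbits g,
    ((g.map (algebraMap K (AlgebraicClosure K))).rootMultiplicity (Quotient.out ω) : ℤ) *
      rootTerm p K (Quotient.out ω)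

end Exponent

/-- `g` is `n`-th-power-free: no non-unit has its `n`-th power dividing `g`. -/
def IsPowerFree {R : Type*} [CommMonoid R] (n : ℕ) (g : R) : Prop :=
  ∀ q : R, q ^ n ∣ g → IsUnit q

end WildExponent

/-!
For a finite extension `L / K` write `c(L / K) = v_K(Δ_{L/K}) - [L : K] + f_{L/K}`, and for `r` in
the algebraic closure put `φ(r) = c(K(r) / K) / [K(r) : K]`. As the Galois orbit of `r` has
`[K(r) : K]` elements, `w_K(g)` is the sum of `φ(r)` over all roots `r` of `g`, counted with
multiplicity (`wildExponent_eq_sum_roots`). This sum is compared for `g` and `h` root by root.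

*Ramification.* If `L / F / K` is a tower with `[L : F] < p`, then `c(L / K) = [L : F] c(F / K)`
(`wildTerm_tower`). In particular `φ(r) = φ(s)` if `K(s)` embeds into `K(r)` with relative degree
smaller than `p`, and `φ(r) = 0` if `[K(r) : K] < p`. The proof compares absolute values. Let `δ`
generate the different of `L / K`, and let `ϖ_K`, `ϖ_L` be uniformizers, `n = [L : K]`. Then
`|ϖ_L| ^ n = |ϖ_K| ^ f` because `n = e f`, and `|ϖ_K| ^ v_K(Δ) = |δ| ^ n` because the discriminant
is the norm of the different. Generators of the different multiply in towers, and for `[L : F] < p`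
the different of `L / F` is generated by `ϖ_F / ϖ_L`, as the trace of `1` is then a unit.

*Roots.* Fix a radius `ρ` smaller than the distances between distinct roots of `g`. The number of
roots of a polynomial in the disc of radius `ρ` around `s` is the last index of a dominant term of
its Taylor expansion at `s` (`isLastDominant_taylor`), and this index does not change under small
perturbations, whether or not they raise the degree. So, for `h` close to `g`, a root `s` of `g` of
multiplicity `m` is approximated by exactly `m` roots `r` of `h`. Krasner's lemma gives
`K(s) ⊆ K(r)`; the conjugates of `r` are close to conjugates of `s`, hence `[K(r) : K(s)] ≤ m`, and
`m < p` as `g` is `p`-th-power-free. Therefore `φ(r) = φ(s)`. The other roots of `h` are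
`deg h - deg g < p` in number and are permuted by the Galois group, so that `φ` vanishes on them.
-/

namespace WildExponent

/-! ### The absolute value and the ring of integers -/

section RingOfIntegers

variable (p : ℕ) [Fact p.Prime]

theorem padicAbs_padic (x : ℚ_[p]) : padicAbs p ℚ_[p] x = ‖x‖₊ :=
  Subtype.ext (spectralNorm_extends (L := ℚ_[p]) x)

section

variable {L E : Type*} [Field L] [Field E] [Algebra ℚ_[p] L] [Algebra ℚ_[p] E]
  [Algebra.IsAlgebraic ℚ_[p] L] [Algebra.IsAlgebraic ℚ_[p] E]

theorem padicAbs_algHom (f : L →ₐ[ℚ_[p]] E) (x : L) : padicAbs p E (f x) = padicAbs p L x := by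
  refine Subtype.ext ?_
  change spectralNorm ℚ_[p] E (f x) = spectralNorm ℚ_[p] L x
  unfold spectralNorm
  rw [minpoly.algHom_eq f f.injective]

theorem padicAbs_algebraMap [Algebra L E] [IsScalarTower ℚ_[p] L E] (x : L) :
    padicAbs p E (algebraMap L E x) = padicAbs p L x :=
  padicAbs_algHom p (IsScalarTower.toAlgHom ℚ_[p] L E) x

theorem padicAbs_natCast_eq_one {n : ℕ} (h0 : n ≠ 0) (hn : n < p) : padicAbs p L n = 1 := by
  have h := padicAbs_algebraMap p (L := ℚ_[p]) (E := L) n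
  rw [map_natCast, padicAbs_padic] at h
  rw [h, ← NNReal.coe_inj, coe_nnnorm, NNReal.coe_one, Padic.norm_natCast_eq_one_iff]
  exact Nat.coprime_of_lt_prime h0 hn Fact.out

theorem mem_ringOfInt_iff (x : L) : x ∈ ringOfInt p L ↔ padicAbs p L x ≤ 1 := Iff.rfl

end

instance isPrincipalIdealRing_ringOfInt_padic : IsPrincipalIdealRing (ringOfInt p ℚ_[p]) := by
  let f : ℤ_[p] →+* ringOfInt p ℚ_[p] :=
    (PadicInt.Coe.ringHom (p := p)).codRestrict _ fun x => by
      rw [mem_ringOfInt_iff, padicAbs_padic]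
      exact x.2
  refine IsPrincipalIdealRing.of_surjective f fun x => ?_
  have h := x.2
  rw [mem_ringOfInt_iff, padicAbs_padic] at h
  exact ⟨⟨x, h⟩, rfl⟩

section

variable (L : Type*) [Field L] [Algebra ℚ_[p] L] [Algebra.IsAlgebraic ℚ_[p] L]

theorem isIntegral_of_mem_ringOfInt {x : L} (hx : x ∈ ringOfInt p L) :
    IsIntegral (ringOfInt p ℚ_[p]) x := by
  have hi : IsIntegral ℚ_[p] x := Algebra.IsIntegral.isIntegral x
  have h : ∀ n, ‖(minpoly ℚ_[p] x).coeff n‖ ≤ 1 :=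
    (spectralValue_le_one_iff (minpoly.monic hi)).1 hx
  have hl : minpoly ℚ_[p] x ∈ Polynomial.lifts (algebraMap (ringOfInt p ℚ_[p]) ℚ_[p]) := by
    rw [Polynomial.lifts_iff_coeff_lifts]
    intro n
    refine ⟨⟨_, ?_⟩, rfl⟩
    rw [mem_ringOfInt_iff, padicAbs_padic]
    exact h n
  obtain ⟨q, hq, -, hm⟩ := Polynomial.lifts_and_natDegree_eq_and_monic hl (minpoly.monic hi)
  refine ⟨q, hm, ?_⟩
  have := minpoly.aeval ℚ_[p] x
  rw [← hq, Polynomial.aeval_map_algebraMap] at this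
  exact this

variable (K : Type*) [Field K] [Algebra ℚ_[p] K] [Algebra.IsAlgebraic ℚ_[p] K] [Algebra K L]
  [IsScalarTower ℚ_[p] K L]

instance isIntegralClosure_ringOfInt : IsIntegralClosure (ringOfInt p L) (ringOfInt p K) L where
  algebraMap_injective := Subtype.val_injective
  isIntegral_iff {x} := by
    constructor
    · intro h
      have h' : IsIntegral (ringOfInt p L) x := h.tower_top
      exact IsIntegrallyClosed.isIntegral_iff.1 h'
    · rintro ⟨y, rfl⟩
      have h := isIntegral_of_mem_ringOfInt p L y.2
      have : IsScalarTower (ringOfInt p ℚ_[p]) (ringOfInt p K) L :=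
        .of_algebraMap_eq fun x => IsScalarTower.algebraMap_apply ℚ_[p] K L x
      exact h.tower_top

end

variable (K : Type*) [Field K] [Algebra ℚ_[p] K] [FiniteDimensional ℚ_[p] K]

instance isDedekindDomain_ringOfInt : IsDedekindDomain (ringOfInt p K) :=
  IsIntegralClosure.isDedekindDomain (ringOfInt p ℚ_[p]) ℚ_[p] K _

/-- The prime `p` is a nonzero non-unit of the ring of integers. -/
theorem not_isField_ringOfInt : ¬ IsField (ringOfInt p K) := by
  have hp : padicAbs p K (p : K) = ‖(p : ℚ_[p])‖₊ := by
    rw [← padicAbs_padic, ← padicAbs_algebraMap p (L := ℚ_[p]) (E := K),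
      map_natCast (algebraMap ℚ_[p] K)]
  have hp1 : ‖(p : ℚ_[p])‖₊ < 1 := Padic.norm_p_lt_one
  have hp0 : (p : ℚ_[p]) ≠ 0 := by
    exact_mod_cast (Fact.out : p.Prime).ne_zero
  intro h
  obtain ⟨y, hy⟩ := h.mul_inv_cancel (a := ⟨(p : K), (hp ▸ hp1.le : padicAbs p K p ≤ 1)⟩) (by
    intro h0
    have : (p : K) = 0 := congrArg Subtype.val h0
    rw [this, map_zero] at hp
    exact hp0 (nnnorm_eq_zero.1 hp.symm))
  have hy' : (p : K) * (y : K) = 1 := congrArg Subtype.val hy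
  have h1 := congrArg (padicAbs p K) hy'
  rw [map_mul, map_one, hp] at h1
  have := mul_lt_one_of_nonneg_of_lt_one_left (zero_le) hp1 y.2
  exact this.ne h1

instance isDiscreteValuationRing_ringOfInt : IsDiscreteValuationRing (ringOfInt p K) :=
  have h : IsDiscreteValuationRing (ringOfInt p K) ↔ IsDedekindDomain (ringOfInt p K) :=
    (IsDiscreteValuationRing.TFAE (ringOfInt p K) (not_isField_ringOfInt p K)).out 0 2
  h.2 inferInstance

end RingOfIntegers

/-! ### Uniformizers, norms, traces and the different -/

theorem associated_pow_multiplicity_maximalIdeal {R : Type*} [CommRing R] [IsDomain R]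
    [IsDiscreteValuationRing R] {ϖ d : R} (hϖ : Irreducible ϖ) (hd : d ≠ 0) :
    Associated d (ϖ ^ multiplicity (IsLocalRing.maximalIdeal R) (Ideal.span {d})) := by
  obtain ⟨n, hn⟩ := IsDiscreteValuationRing.associated_pow_irreducible hd hϖ
  have hI : Ideal.span {d} = IsLocalRing.maximalIdeal R ^ n := by
    rw [hϖ.maximalIdeal_eq, Ideal.span_singleton_pow]
    exact Ideal.span_singleton_eq_span_singleton.2 hn
  rwa [hI, multiplicity_pow_self (IsDiscreteValuationRing.not_a_field R)]
  rw [Ideal.isUnit_iff]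
  exact Ideal.IsPrime.ne_top'

section RingOfIntegers

variable (p : ℕ) [Fact p.Prime] (K : Type*) [Field K] [Algebra ℚ_[p] K] [FiniteDimensional ℚ_[p] K]

theorem padicAbs_unit (u : (ringOfInt p K)ˣ) : padicAbs p K ((u : ringOfInt p K) : K) = 1 := by
  have h : ((u : ringOfInt p K) : K) * (((u⁻¹ : (ringOfInt p K)ˣ) : ringOfInt p K) : K) = 1 :=
    congrArg Subtype.val u.mul_inv
  have h' := congrArg (padicAbs p K) h
  rw [map_mul, map_one] at h'
  refine le_antisymm (u : ringOfInt p K).2 ?_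
  rw [← h']
  exact mul_le_of_le_one_right zero_le ((u⁻¹ : (ringOfInt p K)ˣ) : ringOfInt p K).2

theorem padicAbs_eq_pow_multiplicity {ϖ : ringOfInt p K} (hϖ : Irreducible ϖ)
    {I : Ideal (ringOfInt p K)} {d : ringOfInt p K} (hd : d ≠ 0) (hI : I = Ideal.span {d}) :
    padicAbs p K d =
      padicAbs p K ϖ ^ multiplicity (IsLocalRing.maximalIdeal (ringOfInt p K)) I := by
  obtain ⟨u, hu⟩ := associated_pow_multiplicity_maximalIdeal hϖ hd
  have h := congrArg (fun x : ringOfInt p K => padicAbs p K x) hu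
  simp only [MulMemClass.coe_mul, SubmonoidClass.coe_pow, map_mul, map_pow, padicAbs_unit,
    mul_one] at h
  rw [hI, h]

variable (L : Type*) [Field L] [Algebra ℚ_[p] L] [FiniteDimensional ℚ_[p] L] [Algebra K L]
  [IsScalarTower ℚ_[p] K L] [FiniteDimensional K L] [Algebra.IsSeparable K L]

variable {L} in
theorem padicAbs_norm (x : L) :
    padicAbs p K (Algebra.norm K x) = padicAbs p L x ^ Module.finrank K L := by
  have h := congrArg (padicAbs p (AlgebraicClosure K))
    (Algebra.norm_eq_prod_embeddings K (AlgebraicClosure K) x)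
  rw [padicAbs_algebraMap, map_prod] at h
  rw [h, Finset.prod_congr rfl fun σ _ => padicAbs_algHom p (σ.restrictScalars ℚ_[p]) x,
    Finset.prod_const, Finset.card_univ, AlgHom.card]

variable {L} in
theorem padicAbs_trace_le (x : L) : padicAbs p K (Algebra.trace K L x) ≤ padicAbs p L x := by
  have h := congrArg (padicAbs p (AlgebraicClosure K))
    (trace_eq_sum_embeddings (K := K) (AlgebraicClosure K) (x := x))
  rw [padicAbs_algebraMap] at h
  rw [h]
  exact Valuation.map_sum_le _ fun σ _ => (padicAbs_algHom p (σ.restrictScalars ℚ_[p]) x).le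

instance finite_ringOfInt : Module.Finite (ringOfInt p K) (ringOfInt p L) :=
  IsIntegralClosure.finite _ K L _

instance free_ringOfInt : Module.Free (ringOfInt p K) (ringOfInt p L) :=
  IsIntegralClosure.module_free _ K L _

theorem finrank_ringOfInt :
    Module.finrank (ringOfInt p K) (ringOfInt p L) = Module.finrank K L :=
  IsIntegralClosure.rank _ K L _

open IsLocalRing in
/-- The identity `[L : K] = e f`, with `|ϖ| = |ϖ'| ^ e` used to eliminate `e`. -/
theorem padicAbs_irreducible_pow_finrank {ϖ : ringOfInt p K} (hϖ : Irreducible ϖ)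
    {ϖ' : ringOfInt p L} (hϖ' : Irreducible ϖ') :
    padicAbs p L ϖ' ^ Module.finrank K L = padicAbs p K ϖ ^ residueDegree p K L := by
  have hinj := FaithfulSMul.algebraMap_injective (ringOfInt p K) (ringOfInt p L)
  have hm0 : maximalIdeal (ringOfInt p K) ≠ ⊥ := IsDiscreteValuationRing.not_a_field _
  have hmap : (maximalIdeal (ringOfInt p K)).map (algebraMap (ringOfInt p K) (ringOfInt p L)) =
      Ideal.span {algebraMap (ringOfInt p K) (ringOfInt p L) ϖ} := by
    rw [hϖ.maximalIdeal_eq, Ideal.map_span, Set.image_singleton]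
  have hmap0 : (maximalIdeal (ringOfInt p K)).map
      (algebraMap (ringOfInt p K) (ringOfInt p L)) ≠ ⊥ := Ideal.map_ne_bot_of_ne_bot hm0
  have he := padicAbs_eq_pow_multiplicity p L hϖ' (by
    rw [map_ne_zero_iff _ hinj]; exact hϖ.ne_zero) hmap
  rw [← Ideal.IsDedekindDomain.ramificationIdx_eq_multiplicity _ _ hmap0] at he
  have hov := IsLocalRing.primesOver_eq (ringOfInt p L) hm0
  have hsum : (maximalIdeal (ringOfInt p L)).ramificationIdx (ringOfInt p K) *
      (maximalIdeal (ringOfInt p L)).inertiaDeg (ringOfInt p K) = Module.finrank K L := by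
    rw [← finrank_ringOfInt p K L]
    have : Unique ((maximalIdeal (ringOfInt p K)).primesOver (ringOfInt p L)) := by
      rw [hov]; infer_instance
    rw [← Ideal.sum_ramification_inertia_eq_finrank (maximalIdeal (ringOfInt p K)),
      Fintype.sum_unique]
    have h := this.default.2
    rw [Set.ext_iff.1 hov, Set.mem_singleton_iff] at h
    rw [h]
  have hf : (maximalIdeal (ringOfInt p L)).inertiaDeg (ringOfInt p K) = residueDegree p K L :=
    Ideal.inertiaDeg_eq_of_isMaximal (maximalIdeal (ringOfInt p K)) (maximalIdeal (ringOfInt p L))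
  rw [← hsum, hf, pow_mul, ← he]
  congr 1
  exact padicAbs_algebraMap p (ϖ : K)

/-- `δ` generates the different of `L / K`: the elements `x` such that `Tr (x y)` is integral for
all integral `y` are those with `x δ` integral. -/
def IsDifferentGenerator (δ : L) : Prop :=
  δ ≠ 0 ∧ ∀ x : L, (∀ y : L, padicAbs p L y ≤ 1 →
    padicAbs p K (Algebra.trace K L (x * y)) ≤ 1) ↔ padicAbs p L (x * δ) ≤ 1

theorem exists_isDifferentGenerator : ∃ δ : L, IsDifferentGenerator p K L δ := by
  let I := FractionalIdeal.dual (ringOfInt p K) K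
    (1 : FractionalIdeal (nonZeroDivisors (ringOfInt p L)) L)
  have h10 : (1 : FractionalIdeal (nonZeroDivisors (ringOfInt p L)) L) ≠ 0 := one_ne_zero
  have hI0 : I ≠ 0 := FractionalIdeal.dual_ne_zero _ _ h10
  obtain ⟨y, hy⟩ := (FractionalIdeal.isPrincipal_iff I).1 inferInstance
  have hy0 : y ≠ 0 := by
    rintro rfl
    exact hI0 (by rw [hy, FractionalIdeal.spanSingleton_zero])
  refine ⟨y⁻¹, inv_ne_zero hy0, fun x => ?_⟩
  have h1 : x ∈ I ↔ ∀ y : L, padicAbs p L y ≤ 1 →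
      padicAbs p K (Algebra.trace K L (x * y)) ≤ 1 := by
    rw [FractionalIdeal.mem_dual h10]
    constructor
    · intro h y hy
      obtain ⟨z, hz⟩ := h y ((FractionalIdeal.mem_one_iff _).2 ⟨⟨y, hy⟩, rfl⟩)
      rw [← Algebra.traceForm_apply, ← hz]
      exact z.2
    · intro h a ha
      obtain ⟨y, rfl⟩ := (FractionalIdeal.mem_one_iff _).1 ha
      exact ⟨⟨_, h y y.2⟩, rfl⟩
  rw [← h1, hy, FractionalIdeal.mem_spanSingleton]
  constructor
  · rintro ⟨z, rfl⟩
    rw [Algebra.smul_def, mul_assoc, mul_inv_cancel₀ hy0, mul_one]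
    exact z.2
  · intro h
    exact ⟨⟨_, h⟩, by rw [Algebra.smul_def]; exact inv_mul_cancel_right₀ hy0 x⟩

end RingOfIntegers

/-! ### The discriminant as norm of the different -/

section Discriminant

variable (p : ℕ) [Fact p.Prime] (K : Type*) [Field K] [Algebra ℚ_[p] K] [FiniteDimensional ℚ_[p] K]

theorem padicAbs_det_le_one {n : Type*} [Fintype n] [DecidableEq n] (M : Matrix n n K)
    (hM : ∀ i j, padicAbs p K (M i j) ≤ 1) : padicAbs p K M.det ≤ 1 := by
  let N : Matrix n n (ringOfInt p K) := .of fun i j => ⟨M i j, hM i j⟩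
  have h : (ringOfInt p K).subtype N.det = M.det := by
    rw [RingHom.map_det]
    rfl
  rw [← h]
  exact N.det.2

section

variable {K} {L : Type*} [Field L] [Algebra ℚ_[p] L] [FiniteDimensional ℚ_[p] L] [Algebra K L]

theorem padicAbs_integralBasis_le_one {b : Module.Basis (Fin (Module.finrank K L)) K L}
    (hb : ∀ x : L, padicAbs p L x ≤ 1 ↔ ∀ i, padicAbs p K (b.repr x i) ≤ 1) (i) :
    padicAbs p L (b i) ≤ 1 := by
  rw [hb]
  intro j
  rw [b.repr_self, Finsupp.single_apply]
  split_ifs <;> simp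

/-- Among the bases consisting of integral elements, an integral basis has the largest discriminant
in absolute value. -/
theorem padicAbs_discr_le {b c : Module.Basis (Fin (Module.finrank K L)) K L}
    (hb : ∀ x : L, padicAbs p L x ≤ 1 ↔ ∀ i, padicAbs p K (b.repr x i) ≤ 1)
    (hc : ∀ i, padicAbs p L (c i) ≤ 1) :
    padicAbs p K (Algebra.discr K c) ≤ padicAbs p K (Algebra.discr K b) := by
  have h : Algebra.discr K c = (b.toMatrix c).det ^ 2 * Algebra.discr K b := by
    rw [← Algebra.discr_of_matrix_vecMul, b.toMatrix_map_vecMul]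
  rw [h, map_mul, map_pow]
  refine mul_le_of_le_one_left zero_le (pow_le_one₀ zero_le ?_)
  exact padicAbs_det_le_one p K _ fun i j => (hb (c j)).1 (hc j) i

theorem discIdeal_eq_span [FiniteDimensional K L] [Algebra.IsSeparable K L]
    {b : Module.Basis (Fin (Module.finrank K L)) K L}
    (hb : ∀ x : L, padicAbs p L x ≤ 1 ↔ ∀ i, padicAbs p K (b.repr x i) ≤ 1)
    {d : ringOfInt p K} (hd : (d : K) = Algebra.discr K b) :
    discIdeal p K L = Ideal.span {d} := by
  have hd0 : (d : K) ≠ 0 := hd ▸ Algebra.discr_not_zero_of_basis K b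
  have hbi := padicAbs_integralBasis_le_one p hb
  refine le_antisymm (Ideal.span_le.2 ?_) (Ideal.span_mono ?_)
  · rintro e ⟨c, hc, he⟩
    have h := padicAbs_discr_le p hb hc
    rw [← he, ← hd] at h
    refine Ideal.mem_span_singleton'.2 ⟨⟨e / d, ?_⟩, Subtype.ext (div_mul_cancel₀ _ hd0)⟩
    rw [mem_ringOfInt_iff, map_div₀]
    exact div_le_one_of_le₀ h zero_le
  · rintro _ rfl
    exact ⟨b, hbi, hd⟩

end

variable (L : Type*) [Field L] [Algebra ℚ_[p] L] [FiniteDimensional ℚ_[p] L] [Algebra K L]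
  [IsScalarTower ℚ_[p] K L] [FiniteDimensional K L] [Algebra.IsSeparable K L]

/-- A basis of `L / K` that is also a basis of the ring of integers of `L` over that of `K`. -/
theorem exists_integralBasis : ∃ b : Module.Basis (Fin (Module.finrank K L)) K L,
    ∀ x : L, padicAbs p L x ≤ 1 ↔ ∀ i, padicAbs p K (b.repr x i) ≤ 1 := by
  have : IsLocalization (Algebra.algebraMapSubmonoid (ringOfInt p L)
      (nonZeroDivisors (ringOfInt p K))) L :=
    IsIntegralClosure.isLocalization (ringOfInt p K) K L (ringOfInt p L)
  let b := Module.finBasisOfFinrankEq (ringOfInt p K) (ringOfInt p L) (finrank_ringOfInt p K L)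
  let c := b.localizationLocalization K (nonZeroDivisors (ringOfInt p K)) L
  have hc : ∀ i, c i = b i := fun i => b.localizationLocalization_apply _ _ _ i
  refine ⟨c, fun x => ⟨fun hx i => ?_, fun hx => ?_⟩⟩
  · have h := b.localizationLocalization_repr_algebraMap K (nonZeroDivisors (ringOfInt p K)) L
      ⟨x, hx⟩ i
    exact h ▸ (b.repr ⟨x, hx⟩ i).2
  · rw [← c.sum_repr x]
    refine Valuation.map_sum_le _ fun i _ => ?_
    rw [Algebra.smul_def, map_mul, padicAbs_algebraMap, hc]
    exact mul_le_one' (hx i) (b i).2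

variable {K L}

/-- The discriminant of an integral basis is the norm of a generator of the different, up to
units. Writing `S` for the matrix of `Tr (δ⁻¹ b_i b_j)`, the trace matrix of `b` is `S` times the
matrix of multiplication by `δ`, and `S` is unimodular: its inverse has as columns the coordinates
of `δ` times the dual basis. -/
theorem padicAbs_discr {b : Module.Basis (Fin (Module.finrank K L)) K L}
    (hb : ∀ x : L, padicAbs p L x ≤ 1 ↔ ∀ i, padicAbs p K (b.repr x i) ≤ 1)
    {δ : L} (hδ : IsDifferentGenerator p K L δ) :
    padicAbs p K (Algebra.discr K b) = padicAbs p L δ ^ Module.finrank K L := by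
  have hbi := padicAbs_integralBasis_le_one p hb
  obtain ⟨hδ0, hδ⟩ := hδ
  let S : Matrix (Fin (Module.finrank K L)) (Fin (Module.finrank K L)) K :=
    .of fun i j => Algebra.trace K L (δ⁻¹ * b i * b j)
  let U : Matrix (Fin (Module.finrank K L)) (Fin (Module.finrank K L)) K :=
    .of fun i j => b.repr (b.traceDual j * δ) i
  -- Expanding `y` in the basis turns `∑ k, S i k * (coordinate of y)` into a trace.
  have hS : ∀ (i) (y : L), ∑ k, S i k * b.repr y k = Algebra.trace K L (δ⁻¹ * b i * y) := by
    intro i y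
    conv_rhs => rw [← b.sum_repr y, Finset.mul_sum, map_sum]
    refine Finset.sum_congr rfl fun k _ => ?_
    rw [mul_smul_comm, map_smul, smul_eq_mul, mul_comm]
    rfl
  have hSU : S * U = 1 := by
    ext i j
    rw [Matrix.mul_apply, Matrix.one_apply]
    refine (hS i (b.traceDual j * δ)).trans ?_
    rw [← b.trace_mul_traceDual]
    congr 1
    field_simp
  have hSM : Algebra.traceMatrix K b = S * Algebra.leftMulMatrix b δ := by
    ext i j
    rw [Matrix.mul_apply, Algebra.traceMatrix_apply, Algebra.traceForm_apply]
    simp_rw [Algebra.leftMulMatrix_eq_repr_mul]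
    rw [hS]
    congr 1
    field_simp
  have hS1 : padicAbs p K S.det ≤ 1 := by
    refine padicAbs_det_le_one p K _ fun i j => ?_
    refine (hδ (δ⁻¹ * b i)).2 ?_ _ (hbi j)
    rw [mul_assoc, mul_comm, mul_assoc, mul_inv_cancel₀ hδ0, mul_one]
    exact hbi i
  have hU1 : padicAbs p K U.det ≤ 1 := by
    refine padicAbs_det_le_one p K _ fun i j => (hb _).1 ((hδ _).1 fun y hy => ?_) i
    rw [← b.sum_repr y, Finset.mul_sum, map_sum]
    refine Valuation.map_sum_le _ fun k _ => ?_
    rw [mul_smul_comm, map_smul, smul_eq_mul, b.trace_traceDual_mul, map_mul]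
    refine mul_le_one' ((hb y).1 hy k) ?_
    split_ifs <;> simp
  have hdet : padicAbs p K S.det = 1 := by
    have h := congrArg (fun M => padicAbs p K (Matrix.det M)) hSU
    simp only [Matrix.det_mul, map_mul, Matrix.det_one, map_one] at h
    exact le_antisymm hS1 (h ▸ mul_le_of_le_one_right zero_le hU1)
  rw [Algebra.discr_def, hSM, Matrix.det_mul, map_mul, hdet, one_mul,
    ← Algebra.norm_eq_matrix_det, padicAbs_norm]

variable (K) in
theorem padicAbs_pow_discExponent {ϖ : ringOfInt p K} (hϖ : Irreducible ϖ) {δ : L}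
    (hδ : IsDifferentGenerator p K L δ) :
    padicAbs p K ϖ ^ discExponent p K L = padicAbs p L δ ^ Module.finrank K L := by
  obtain ⟨b, hb⟩ := exists_integralBasis p K L
  have hbi := padicAbs_integralBasis_le_one p hb
  have hd : Algebra.discr K b ∈ ringOfInt p K := by
    rw [mem_ringOfInt_iff, Algebra.discr_def]
    refine padicAbs_det_le_one p K _ fun i j => (padicAbs_trace_le p K _).trans ?_
    change padicAbs p L (b i * b j) ≤ 1
    rw [map_mul]
    exact mul_le_one' (hbi i) (hbi j)
  rw [← padicAbs_discr p hb hδ]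
  refine (padicAbs_eq_pow_multiplicity p K hϖ (d := ⟨_, hd⟩) ?_ (discIdeal_eq_span p hb rfl)).symm
  exact fun h => Algebra.discr_not_zero_of_basis K b (congrArg Subtype.val h)

end Discriminant

/-! ### Towers of degree smaller than `p` -/

section Tower

variable (p : ℕ) [Fact p.Prime] (K F L : Type*) [Field K] [Algebra ℚ_[p] K]
  [FiniteDimensional ℚ_[p] K] [Field F] [Algebra ℚ_[p] F]
  [FiniteDimensional ℚ_[p] F] [Field L] [Algebra ℚ_[p] L] [FiniteDimensional ℚ_[p] L]

theorem padicAbs_pos {x : K} (hx : x ≠ 0) : 0 < padicAbs p K x :=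
  pos_iff_ne_zero.2 ((padicAbs p K).ne_zero_iff.2 hx)

theorem padicAbs_irreducible_lt_one {ϖ : ringOfInt p K} (hϖ : Irreducible ϖ) :
    padicAbs p K ϖ < 1 := by
  refine lt_of_le_of_ne ϖ.2 fun h => hϖ.not_isUnit ?_
  have h0 : (ϖ : K) ≠ 0 := fun h0 => by simp [h0] at h
  refine IsUnit.of_mul_eq_one ⟨(ϖ : K)⁻¹, ?_⟩ (Subtype.ext (mul_inv_cancel₀ h0))
  rw [mem_ringOfInt_iff, map_inv₀, h, inv_one]

theorem padicAbs_lt_one_iff {ϖ : ringOfInt p K} (hϖ : Irreducible ϖ) (x : K) :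
    padicAbs p K x < 1 ↔ padicAbs p K x ≤ padicAbs p K ϖ := by
  refine ⟨fun h => ?_, fun h => h.trans_lt (padicAbs_irreducible_lt_one p K hϖ)⟩
  rcases eq_or_ne x 0 with rfl | hx
  · simp
  obtain ⟨n, u, hu⟩ := IsDiscreteValuationRing.associated_pow_irreducible
    (x := (⟨x, h.le⟩ : ringOfInt p K)) (fun h => hx (congrArg Subtype.val h)) hϖ
  have h' := congrArg (fun x : ringOfInt p K => padicAbs p K x) hu
  simp only [MulMemClass.coe_mul, SubmonoidClass.coe_pow, map_mul, map_pow, padicAbs_unit,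
    mul_one] at h'
  rw [h'] at h ⊢
  cases n with
  | zero => simp at h
  | succ n => exact pow_le_of_le_one zero_le ϖ.2 n.succ_ne_zero

variable [Algebra K F] [Algebra K L] [Algebra F L] [IsScalarTower K F L]
  [IsScalarTower ℚ_[p] F L] [FiniteDimensional K F] [FiniteDimensional F L]
  [Algebra.IsSeparable F L]

/-- If the degree is smaller than `p`, it is a unit, so that the trace maps the ring of integers
onto the ring of integers and the maximal ideal into the maximal ideal. Hence the different is
generated by the quotient of the two uniformizers. -/
theorem isDifferentGenerator_of_finrank_lt (h : Module.finrank F L < p)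
    {ϖ : ringOfInt p F} (hϖ : Irreducible ϖ) {ϖ' : ringOfInt p L} (hϖ' : Irreducible ϖ') :
    IsDifferentGenerator p F L (algebraMap F L ϖ / ϖ') := by
  have h0 : (ϖ : F) ≠ 0 := fun h => hϖ.ne_zero (Subtype.ext h)
  have h0' : (ϖ' : L) ≠ 0 := fun h => hϖ'.ne_zero (Subtype.ext h)
  have h1 : algebraMap F L ϖ ≠ 0 := (_root_.map_ne_zero _).2 h0
  refine ⟨div_ne_zero h1 h0', fun x => ⟨fun hx => ?_, fun hx y hy => ?_⟩⟩
  · rw [mul_div_assoc', map_div₀]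
    refine div_le_one_of_le₀ ?_ zero_le
    rw [← padicAbs_lt_one_iff p L hϖ']
    by_contra! hlt
    have hx0 : x * algebraMap F L ϖ ≠ 0 := fun h => by simp [h] at hlt
    have h2 := hx (x * algebraMap F L ϖ)⁻¹ (by rw [map_inv₀]; exact inv_le_one_of_one_le₀ hlt)
    have h3 : x * (x * algebraMap F L ϖ)⁻¹ = (ϖ : F)⁻¹ • (1 : L) := by
      rw [Algebra.smul_def, map_inv₀]
      have := left_ne_zero_of_mul hx0
      field_simp
    have h4 : Algebra.trace F L 1 = (Module.finrank F L : F) := by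
      rw [← map_one (algebraMap F L), Algebra.trace_algebraMap, nsmul_eq_mul, mul_one]
    rw [h3, map_smul, smul_eq_mul, h4, map_mul,
      padicAbs_natCast_eq_one p Module.finrank_pos.ne' h, mul_one, map_inv₀] at h2
    have h5 := padicAbs_irreducible_lt_one p F hϖ
    exact h2.not_gt ((one_lt_inv₀ (padicAbs_pos p F h0)).2 h5)
  · have h2 : padicAbs p L (x * y * algebraMap F L ϖ) < 1 := by
      rw [padicAbs_lt_one_iff p L hϖ']
      have h3 : x * y * algebraMap F L ϖ = (x * (algebraMap F L ϖ / ϖ')) * y * ϖ' := by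
        field_simp
      rw [h3, map_mul, map_mul]
      exact mul_le_of_le_one_left zero_le (mul_le_one' hx hy)
    have h3 := (padicAbs_trace_le p F (x * y * algebraMap F L ϖ)).trans_lt h2
    rw [padicAbs_lt_one_iff p F hϖ, mul_comm, ← Algebra.smul_def, map_smul, smul_eq_mul,
      map_mul] at h3
    exact (mul_le_iff_le_one_right (padicAbs_pos p F h0)).1 h3

variable {F L} in
/-- Transitivity of the different. -/
theorem IsDifferentGenerator.mul {δ : F} {δ' : L} (hδ : IsDifferentGenerator p K F δ)
    (hδ' : IsDifferentGenerator p F L δ') :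
    IsDifferentGenerator p K L (algebraMap F L δ * δ') := by
  refine ⟨mul_ne_zero ((_root_.map_ne_zero _).2 hδ.1) hδ'.1, fun x => ?_⟩
  rw [← mul_assoc, ← hδ'.2]
  have h1 : ∀ y, Algebra.trace F L (x * algebraMap F L δ * y) =
      Algebra.trace F L (x * y) * δ := fun y => by
    rw [mul_right_comm, mul_comm, ← Algebra.smul_def, map_smul, smul_eq_mul, mul_comm]
  constructor
  · intro hx y hy
    rw [h1, ← hδ.2]
    intro z hz
    have h2 : Algebra.trace F L (x * y) * z = Algebra.trace F L (x * (y * algebraMap F L z)) := by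
      rw [← mul_assoc x, mul_comm (x * y), ← Algebra.smul_def, map_smul, smul_eq_mul, mul_comm]
    rw [h2, Algebra.trace_trace]
    refine hx _ ?_
    rw [map_mul, padicAbs_algebraMap]
    exact mul_le_one' hy hz
  · intro hx y hy
    have h2 := hx y hy
    rw [h1, ← hδ.2] at h2
    have h3 := h2 1 (by simp)
    rwa [mul_one, Algebra.trace_trace] at h3

/-- The term `v_K(Δ_{L/K}) - [L : K] + f_{L/K}` attached to a finite extension `L / K`. -/
noncomputable def wildTerm (p : ℕ) [Fact p.Prime] (K L : Type*) [Field K] [Field L]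
    [Algebra ℚ_[p] K] [Algebra ℚ_[p] L] [Algebra K L] [IsScalarTower ℚ_[p] K L]
    [Algebra.IsAlgebraic ℚ_[p] K] [Algebra.IsAlgebraic ℚ_[p] L] : ℤ :=
  (discExponent p K L : ℤ) - (Module.finrank K L : ℤ) + (residueDegree p K L : ℤ)

variable [IsScalarTower ℚ_[p] K F] [IsScalarTower ℚ_[p] K L] [FiniteDimensional K L]
  [Algebra.IsSeparable K F] [Algebra.IsSeparable K L]

/-- In a tower `L / F / K` with `[L : F] < p` the wild term is multiplied by `[L : F]`. -/
theorem wildTerm_tower (h : Module.finrank F L < p) :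
    wildTerm p K L = Module.finrank F L * wildTerm p K F := by
  obtain ⟨ϖ, hϖ⟩ := IsDiscreteValuationRing.exists_irreducible (ringOfInt p K)
  obtain ⟨ϖF, hϖF⟩ := IsDiscreteValuationRing.exists_irreducible (ringOfInt p F)
  obtain ⟨ϖL, hϖL⟩ := IsDiscreteValuationRing.exists_irreducible (ringOfInt p L)
  obtain ⟨δ, hδ⟩ := exists_isDifferentGenerator p K F
  have hL := padicAbs_pow_discExponent p K hϖ
    (hδ.mul p K (isDifferentGenerator_of_finrank_lt p F L h hϖF hϖL))
  have hF := padicAbs_pow_discExponent p K hϖ hδ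
  have hfL := padicAbs_irreducible_pow_finrank p K L hϖ hϖL
  have hfF := padicAbs_irreducible_pow_finrank p K F hϖ hϖF
  have hn := Module.finrank_mul_finrank K F L
  have h0 : (ϖ : K) ≠ 0 := fun h => hϖ.ne_zero (Subtype.ext h)
  have h0L : padicAbs p L ϖL ≠ 0 :=
    (padicAbs_pos p L fun h => hϖL.ne_zero (Subtype.ext h)).ne'
  have key : padicAbs p K ϖ ^ (discExponent p K L + residueDegree p K L) =
      padicAbs p K ϖ ^ ((discExponent p K F + residueDegree p K F) * Module.finrank F L) := by
    rw [pow_add, hL, ← hfL, pow_mul, pow_add, hF, ← hfF, ← mul_pow, ← mul_pow, ← pow_mul, hn,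
      map_mul, map_div₀, padicAbs_algebraMap, padicAbs_algebraMap, mul_assoc,
      div_mul_cancel₀ _ h0L]
  have h1 := pow_right_injective₀ (padicAbs_pos p K h0)
    (padicAbs_irreducible_lt_one p K hϖ).ne key
  have h2 : (discExponent p K L : ℤ) + residueDegree p K L =
      (discExponent p K F + residueDegree p K F) * Module.finrank F L := by exact_mod_cast h1
  unfold wildTerm
  rw [← hn]
  push_cast
  linear_combination h2

end Tower

/-! ### Counting roots in discs -/

section RootCounting

variable {E : Type*} [Field E] (v : Valuation E NNReal) (ρ : NNReal)

/-- `k` is the last index at which `|a_i| ρ ^ i` takes its maximal value, where the `a_i` are the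
coefficients of `f`, and this maximum is not zero: on the Newton polygon of `f`, the right end of
the segment of slope `log ρ`. -/
def IsLastDominant (f : E[X]) (k : ℕ) : Prop :=
  0 < v (f.coeff k) * ρ ^ k ∧ (∀ i, v (f.coeff i) * ρ ^ i ≤ v (f.coeff k) * ρ ^ k) ∧
    ∀ i, k < i → v (f.coeff i) * ρ ^ i < v (f.coeff k) * ρ ^ k

variable {v ρ}

theorem IsLastDominant.unique {f : E[X]} {k l : ℕ} (hk : IsLastDominant v ρ f k)
    (hl : IsLastDominant v ρ f l) : k = l := by
  rcases lt_trichotomy k l with h | h | h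
  · exact absurd (hk.2.2 l h) (hl.2.1 k).not_gt
  · exact h
  · exact absurd (hl.2.2 k h) (hk.2.1 l).not_gt

/-- The index is unchanged by perturbations smaller than the dominant term. -/
theorem IsLastDominant.of_sub_lt {f g : E[X]} {k : ℕ} (hk : IsLastDominant v ρ f k)
    (h : ∀ i, v ((g - f).coeff i) * ρ ^ i < v (f.coeff k) * ρ ^ k) :
    IsLastDominant v ρ g k := by
  have hi : ∀ i, v (g.coeff i) * ρ ^ i ≤
      max (v (f.coeff i) * ρ ^ i) (v ((g - f).coeff i) * ρ ^ i) := fun i => by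
    rw [← max_mul_of_nonneg _ _ zero_le]
    refine mul_le_mul_left ?_ _
    have := v.map_add (f.coeff i) ((g - f).coeff i)
    rwa [← coeff_add, add_sub_cancel] at this
  have hgk : v (g.coeff k) = v (f.coeff k) := by
    have h1 : v ((g - f).coeff k) < v (f.coeff k) := lt_of_mul_lt_mul_right (h k) zero_le
    have := v.map_add_eq_of_lt_left h1
    rwa [← coeff_add, add_sub_cancel] at this
  refine ⟨by rw [hgk]; exact hk.1, fun i => ?_, fun i hki => ?_⟩
  · rw [hgk]
    exact (hi i).trans (max_le (hk.2.1 i) (h i).le)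
  · rw [hgk]
    exact (hi i).trans_lt (max_lt (hk.2.2 i hki) (h i))

theorem isLastDominant_C {c : E} (hc : c ≠ 0) : IsLastDominant v ρ (C c) 0 := by
  have h0 : 0 < v c := pos_iff_ne_zero.2 (v.ne_zero_iff.2 hc)
  refine ⟨by simpa using h0, fun i => ?_, fun i hi => ?_⟩
  · cases i <;> simp
  · simpa [coeff_C, hi.ne'] using h0

theorem coeff_succ_X_sub_C_mul (f : E[X]) (r : E) (i : ℕ) :
    ((X - C r) * f).coeff (i + 1) = f.coeff i - r * f.coeff (i + 1) := by
  rw [sub_mul, coeff_sub, coeff_X_mul, coeff_C_mul]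

theorem map_coeff_succ_X_sub_C_mul_le (f : E[X]) (r : E) (i : ℕ) :
    v (((X - C r) * f).coeff (i + 1)) * ρ ^ (i + 1) ≤
      max (ρ * (v (f.coeff i) * ρ ^ i)) (v r * (v (f.coeff (i + 1)) * ρ ^ (i + 1))) := by
  rw [coeff_succ_X_sub_C_mul]
  refine (mul_le_mul_left (v.map_sub _ _) _).trans ?_
  rw [max_mul_of_nonneg _ _ zero_le, map_mul]
  refine max_le_max (le_of_eq ?_) (le_of_eq ?_)
  · ring
  · ring

theorem IsLastDominant.mul_of_le (hρ : 0 < ρ) {f : E[X]} {k : ℕ} (hk : IsLastDominant v ρ f k)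
    {r : E} (hr : v r ≤ ρ) : IsLastDominant v ρ ((X - C r) * f) (k + 1) := by
  have hlead : v (((X - C r) * f).coeff (k + 1)) = v (f.coeff k) := by
    rw [coeff_succ_X_sub_C_mul]
    refine v.map_sub_eq_of_lt_left ?_
    rw [map_mul]
    have h1 := hk.2.2 (k + 1) k.lt_succ_self
    rw [pow_succ', ← mul_assoc] at h1
    have h2 := lt_of_mul_lt_mul_right h1 zero_le
    calc v r * v (f.coeff (k + 1)) ≤ ρ * v (f.coeff (k + 1)) := mul_le_mul_left hr _
      _ = v (f.coeff (k + 1)) * ρ := mul_comm _ _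
      _ < _ := h2
  have hM : v (((X - C r) * f).coeff (k + 1)) * ρ ^ (k + 1) =
      ρ * (v (f.coeff k) * ρ ^ k) := by
    rw [hlead]; ring
  refine ⟨?_, fun i => ?_, fun i hi => ?_⟩
  · rw [hM]
    exact mul_pos hρ hk.1
  · rw [hM]
    cases i with
    | zero =>
      have : v (((X - C r) * f).coeff 0) * ρ ^ 0 = v r * (v (f.coeff 0) * ρ ^ 0) := by
        simp [mul_coeff_zero]
      rw [this]
      exact mul_le_mul' hr (hk.2.1 0)
    | succ i =>
      exact (map_coeff_succ_X_sub_C_mul_le f r i).trans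
        (max_le (mul_le_mul' le_rfl (hk.2.1 i)) (mul_le_mul' hr (hk.2.1 _)))
  · rw [hM]
    cases i with
    | zero => omega
    | succ i =>
      refine (map_coeff_succ_X_sub_C_mul_le f r i).trans_lt (max_lt ?_ ?_)
      · exact mul_lt_mul_of_pos_left (hk.2.2 i (by omega)) hρ
      · exact (mul_le_mul' hr le_rfl).trans_lt
          (mul_lt_mul_of_pos_left (hk.2.2 (i + 1) (by omega)) hρ)

theorem IsLastDominant.mul_of_lt {f : E[X]} {k : ℕ} (hk : IsLastDominant v ρ f k)
    {r : E} (hr : ρ < v r) : IsLastDominant v ρ ((X - C r) * f) k := by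
  have hr0 : 0 < v r := zero_le.trans_lt hr
  have hM : v (((X - C r) * f).coeff k) * ρ ^ k = v r * (v (f.coeff k) * ρ ^ k) := by
    cases k with
    | zero => simp [mul_coeff_zero]
    | succ k =>
      rw [coeff_succ_X_sub_C_mul, v.map_sub_eq_of_lt_right, map_mul, mul_assoc]
      rw [map_mul]
      refine lt_of_mul_lt_mul_right (a := ρ ^ (k + 1)) ?_ zero_le
      calc v (f.coeff k) * ρ ^ (k + 1) = ρ * (v (f.coeff k) * ρ ^ k) := by ring
        _ ≤ ρ * (v (f.coeff (k + 1)) * ρ ^ (k + 1)) := mul_le_mul' le_rfl (hk.2.1 k)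
        _ < v r * (v (f.coeff (k + 1)) * ρ ^ (k + 1)) := mul_lt_mul_of_pos_right hr hk.1
        _ = _ := by ring
  refine ⟨?_, fun i => ?_, fun i hi => ?_⟩
  · rw [hM]
    exact mul_pos hr0 hk.1
  · rw [hM]
    cases i with
    | zero =>
      have : v (((X - C r) * f).coeff 0) * ρ ^ 0 = v r * (v (f.coeff 0) * ρ ^ 0) := by
        simp [mul_coeff_zero]
      rw [this]
      exact mul_le_mul' le_rfl (hk.2.1 0)
    | succ i =>
      exact (map_coeff_succ_X_sub_C_mul_le f r i).trans
        (max_le (mul_le_mul' hr.le (hk.2.1 i)) (mul_le_mul' le_rfl (hk.2.1 _)))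
  · rw [hM]
    cases i with
    | zero => omega
    | succ i =>
      refine (map_coeff_succ_X_sub_C_mul_le f r i).trans_lt (max_lt ?_ ?_)
      · exact (mul_le_mul' le_rfl (hk.2.1 i)).trans_lt (mul_lt_mul_of_pos_right hr hk.1)
      · exact mul_lt_mul_of_pos_left (hk.2.2 (i + 1) hi) hr0

theorem isLastDominant_taylor_prod (hρ : 0 < ρ) (s : E) {c : E} (hc : c ≠ 0) (R : Multiset E) :
    IsLastDominant v ρ (taylor s (C c * (R.map fun r => X - C r).prod))
      (R.countP fun r => v (r - s) ≤ ρ) := by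
  induction R using Multiset.induction with
  | empty => simpa using isLastDominant_C hc
  | cons r R ih =>
    have h : taylor s (C c * ((r ::ₘ R).map fun r => X - C r).prod) =
        (X - C (r - s)) * taylor s (C c * (R.map fun r => X - C r).prod) := by
      rw [Multiset.map_cons, Multiset.prod_cons, mul_left_comm, taylor_mul, map_sub, taylor_X,
        taylor_C, C_sub]
      ring
    rw [h]
    by_cases hr : v (r - s) ≤ ρ
    · rw [Multiset.countP_cons_of_pos (p := fun r => v (r - s) ≤ ρ) _ hr]
      exact ih.mul_of_le hρ hr
    · rw [Multiset.countP_cons_of_neg (p := fun r => v (r - s) ≤ ρ) _ hr]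
      exact ih.mul_of_lt (not_le.1 hr)

/-- The number of roots of `f` in the disc of radius `ρ` around `s` is read off from the Newton
polygon of the Taylor expansion of `f` at `s`. -/
theorem isLastDominant_taylor [IsAlgClosed E] (hρ : 0 < ρ) (s : E) {f : E[X]} (hf : f ≠ 0) :
    IsLastDominant v ρ (taylor s f) (f.roots.countP fun r => v (r - s) ≤ ρ) := by
  have h := isLastDominant_taylor_prod (v := v) hρ s (leadingCoeff_ne_zero.2 hf) f.roots
  rwa [C_leadingCoeff_mul_prod_multiset_X_sub_C
    (splits_iff_card_roots.1 (IsAlgClosed.splits f))] at h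

theorem exists_taylor_coeff_lt (s : E) (N : ℕ) {M : NNReal} (hM : 0 < M) :
    ∃ ε : NNReal, 0 < ε ∧ ∀ f : E[X], f.natDegree < N → (∀ j, v (f.coeff j) < ε) →
      ∀ i, v ((taylor s f).coeff i) * ρ ^ i < M := by
  let B : NNReal := ∑ i ∈ Finset.range N, ∑ j ∈ Finset.range N,
    v (((X + C s) ^ j : E[X]).coeff i) * ρ ^ i
  have hB : 0 < B + 1 := add_pos_of_nonneg_of_pos zero_le one_pos
  refine ⟨M / (B + 1), div_pos hM hB, fun f hf hc i => ?_⟩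
  rcases lt_or_ge i N with hi | hi
  · have hexp : (taylor s f).coeff i =
        ∑ j ∈ Finset.range N, f.coeff j * ((X + C s) ^ j : E[X]).coeff i := by
      conv_lhs => rw [f.as_sum_range' N hf, map_sum, finsetSum_coeff]
      refine Finset.sum_congr rfl fun j _ => ?_
      rw [← C_mul_X_pow_eq_monomial, taylor_mul, taylor_C, taylor_X_pow, coeff_C_mul]
    rcases eq_or_ne (ρ ^ i) 0 with h0 | h0
    · rwa [h0, mul_zero]
    rw [← lt_div_iff₀ (pos_iff_ne_zero.2 h0), hexp]
    refine v.map_sum_lt (div_pos hM (pos_iff_ne_zero.2 h0)).ne' fun j hj => ?_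
    rw [lt_div_iff₀ (pos_iff_ne_zero.2 h0), map_mul, mul_assoc]
    have hb : v (((X + C s) ^ j : E[X]).coeff i) * ρ ^ i ≤ B :=
      (Finset.single_le_sum (f := fun j => v (((X + C s) ^ j : E[X]).coeff i) * ρ ^ i)
        (fun _ _ => zero_le) hj).trans
      (Finset.single_le_sum (f := fun i => ∑ j ∈ Finset.range N,
        v (((X + C s) ^ j : E[X]).coeff i) * ρ ^ i) (fun _ _ => zero_le) (Finset.mem_range.2 hi))
    calc v (f.coeff j) * (v (((X + C s) ^ j : E[X]).coeff i) * ρ ^ i)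
        ≤ v (f.coeff j) * (B + 1) := mul_le_mul' le_rfl (hb.trans (le_add_of_nonneg_right zero_le))
      _ < M / (B + 1) * (B + 1) := mul_lt_mul_of_pos_right (hc j) hB
      _ = M := div_mul_cancel₀ _ hB.ne'
  · rw [coeff_eq_zero_of_natDegree_lt (by rw [natDegree_taylor]; omega), map_zero, zero_mul]
    exact hM

theorem exists_forall_mem_of_antitone {ι : Type*} (S : Finset ι) {P : ι → NNReal → Prop}
    (hP : ∀ i ∈ S, ∃ ε, 0 < ε ∧ P i ε) (hanti : ∀ i ε ε', ε' ≤ ε → P i ε → P i ε') :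
    ∃ ε, 0 < ε ∧ ∀ i ∈ S, P i ε := by
  classical
  induction S using Finset.induction with
  | empty => exact ⟨1, one_pos, by simp⟩
  | insert a S _ ih =>
    obtain ⟨ε, h0, h⟩ := ih fun i hi => hP i (Finset.mem_insert_of_mem hi)
    obtain ⟨ε', h0', h'⟩ := hP a (Finset.mem_insert_self a S)
    refine ⟨min ε ε', lt_min h0 h0', fun i hi => ?_⟩
    rcases Finset.mem_insert.1 hi with rfl | hi
    · exact hanti _ _ _ (min_le_right _ _) h'
    · exact hanti _ _ _ (min_le_left _ _) (h i hi)

/-- Continuity of roots, also when the degree is allowed to grow: the number of roots in given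
discs does not change under small perturbations of the coefficients. -/
theorem exists_countP_roots_eq [IsAlgClosed E] (v : Valuation E NNReal) (hρ : 0 < ρ) {g : E[X]}
    (hg : g ≠ 0) (S : Finset E) (N : ℕ) (hN : g.natDegree < N) :
    ∃ ε : NNReal, 0 < ε ∧ ∀ h : E[X], h ≠ 0 → h.natDegree < N →
      (∀ i, v (h.coeff i - g.coeff i) < ε) → ∀ s ∈ S,
      h.roots.countP (fun r => v (r - s) ≤ ρ) = g.roots.countP fun r => v (r - s) ≤ ρ := by
  have key : ∀ s ∈ S, ∃ ε : NNReal, 0 < ε ∧ ∀ h : E[X], h ≠ 0 → h.natDegree < N →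
      (∀ i, v (h.coeff i - g.coeff i) < ε) →
      h.roots.countP (fun r => v (r - s) ≤ ρ) = g.roots.countP fun r => v (r - s) ≤ ρ := by
    intro s _
    have hdom := isLastDominant_taylor (v := v) hρ s hg
    obtain ⟨ε, hε, H⟩ := exists_taylor_coeff_lt (v := v) (ρ := ρ) s N hdom.1
    refine ⟨ε, hε, fun h h0 hd hc => (isLastDominant_taylor (v := v) hρ s h0).unique
      (hdom.of_sub_lt fun i => ?_)⟩
    rw [← map_sub]
    refine H _ ?_ (fun j => by rw [coeff_sub]; exact hc j) i
    exact (natDegree_sub_le _ _).trans_lt (max_lt hd hN)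
  obtain ⟨ε, hε, H⟩ := exists_forall_mem_of_antitone S key
    fun s ε ε' hle H h h0 hd hc => H h h0 hd fun i => (hc i).trans_le hle
  exact ⟨ε, hε, fun h h0 hd hc s hs => H s hs h h0 hd hc⟩

end RootCounting

/-! ### Conjugates and multiplicities of roots -/

section Conjugates

theorem charZero_of_algebra_padic (p : ℕ) [Fact p.Prime] (K : Type*) [Field K] [Algebra ℚ_[p] K] :
    CharZero K :=
  charZero_of_injective_algebraMap (algebraMap ℚ_[p] K).injective

variable {K : Type*} [Field K]

open Classical in
/-- The conjugates of `r` over `K`. -/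
noncomputable def conjugates (r : AlgebraicClosure K) : Finset (AlgebraicClosure K) :=
  ((minpoly K r).aroots (AlgebraicClosure K)).toFinset

theorem mem_conjugates {r x : AlgebraicClosure K} :
    x ∈ conjugates r ↔ minpoly K x = minpoly K r := by
  classical
  have hr : IsIntegral K r := Algebra.IsIntegral.isIntegral r
  rw [conjugates, Multiset.mem_toFinset, mem_aroots]
  constructor
  · rintro ⟨-, h⟩
    exact (minpoly.eq_of_irreducible_of_monic (minpoly.irreducible hr) h (minpoly.monic hr)).symm
  · intro h
    exact ⟨minpoly.ne_zero hr, h ▸ minpoly.aeval K x⟩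

theorem mem_conjugates_iff_exists {r x : AlgebraicClosure K} :
    x ∈ conjugates r ↔ ∃ σ : AlgebraicClosure K ≃ₐ[K] AlgebraicClosure K, σ r = x := by
  rw [mem_conjugates, Normal.minpoly_eq_iff_mem_orbit]
  rfl

theorem card_conjugates [CharZero K] (r : AlgebraicClosure K) :
    (conjugates r).card = Module.finrank K K⟮r⟯ := by
  classical
  have hr : IsIntegral K r := Algebra.IsIntegral.isIntegral r
  have hs : (minpoly K r).Separable := (minpoly.irreducible hr).separable
  rw [conjugates, Multiset.toFinset_card_of_nodup (nodup_roots hs.map),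
    IntermediateField.adjoin.finrank hr,
    splits_iff_card_roots.1 (IsAlgClosed.splits ((minpoly K r).map _)), natDegree_map]

theorem rootMultiplicity_algEquiv (g : K[X]) (σ : AlgebraicClosure K ≃ₐ[K] AlgebraicClosure K)
    (r : AlgebraicClosure K) :
    (g.map (algebraMap K (AlgebraicClosure K))).rootMultiplicity (σ r) =
      (g.map (algebraMap K (AlgebraicClosure K))).rootMultiplicity r := by
  have h := eq_rootMultiplicity_map (p := g.map (algebraMap K (AlgebraicClosure K)))
    (f := (σ : AlgebraicClosure K →+* AlgebraicClosure K)) σ.injective r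
  rw [Polynomial.map_map] at h
  have hσ : (σ : AlgebraicClosure K →+* AlgebraicClosure K).comp
      (algebraMap K (AlgebraicClosure K)) = algebraMap K (AlgebraicClosure K) :=
    RingHom.ext σ.commutes
  rw [hσ] at h
  exact h.symm

/-- In characteristic zero the multiplicity of a root `r` of `g` in the algebraic closure is the
exponent of the minimal polynomial of `r` in `g`. -/
theorem IsPowerFree.rootMultiplicity_lt [CharZero K] {n : ℕ} {g : K[X]} (hg : IsPowerFree n g)
    (r : AlgebraicClosure K) :
    (g.map (algebraMap K (AlgebraicClosure K))).rootMultiplicity r < n := by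
  classical
  have hr : IsIntegral K r := Algebra.IsIntegral.isIntegral r
  have hs : (minpoly K r).Separable := (minpoly.irreducible hr).separable
  have hg0 : g ≠ 0 := by
    rintro rfl
    exact not_isUnit_zero (hg 0 (dvd_zero _))
  obtain ⟨q, hq, hdvd⟩ :=
    (FiniteMultiplicity.of_prime_left (minpoly.prime hr) hg0).exists_eq_pow_mul_and_not_dvd
  set m := multiplicity (minpoly K r) g
  have hm : m < n := by
    by_contra! h
    exact minpoly.not_isUnit K r (hg _ ((pow_dvd_pow _ h).trans ⟨q, hq⟩))
  have hq0 : (q.map (algebraMap K (AlgebraicClosure K))).rootMultiplicity r = 0 := by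
    rw [rootMultiplicity_eq_zero_iff]
    intro h
    refine absurd (minpoly.dvd K r ?_) hdvd
    rwa [IsRoot.def, eval_map_algebraMap] at h
  have h1 := rootMultiplicity_le_one_of_separable
    (hs.map (f := algebraMap K (AlgebraicClosure K))) r
  have h2 : g.map (algebraMap K (AlgebraicClosure K)) ≠ 0 :=
    (Polynomial.map_ne_zero_iff (algebraMap K _).injective).2 hg0
  rw [hq, Polynomial.map_mul, Polynomial.map_pow] at h2
  rw [hq, Polynomial.map_mul, Polynomial.map_pow, rootMultiplicity_mul h2, hq0, add_zero,
    ← count_roots, roots_pow, Multiset.count_nsmul, count_roots]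
  exact (mul_le_of_le_one_right (Nat.zero_le _) h1).trans_lt hm

end Conjugates

/-! ### The wild exponent as a sum over roots -/

section MeanRootTerm

variable (p : ℕ) [Fact p.Prime] {K : Type*} [Field K] [Algebra ℚ_[p] K] [FiniteDimensional ℚ_[p] K]

/-- The embedding `f` makes `L` an extension of `F`. With `F` and `L` conjugate subfields of an
algebraic closure this yields the invariance of the wild term under the Galois group. -/
theorem wildTerm_of_algHom {F L : Type*} [Field F] [Field L] [Algebra ℚ_[p] F] [Algebra ℚ_[p] L]
    [Algebra K F] [Algebra K L] [IsScalarTower ℚ_[p] K F] [IsScalarTower ℚ_[p] K L]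
    [FiniteDimensional K F] [FiniteDimensional K L] [FiniteDimensional ℚ_[p] F]
    [FiniteDimensional ℚ_[p] L] (f : F →ₐ[K] L)
    (h : Module.finrank K L < p * Module.finrank K F) :
    wildTerm p K L * Module.finrank K F = wildTerm p K F * Module.finrank K L := by
  have := charZero_of_algebra_padic p K
  have := charZero_of_algebra_padic p F
  let := f.toRingHom.toAlgebra
  have : IsScalarTower K F L := .of_algebraMap_eq' f.comp_algebraMap.symm
  have : IsScalarTower ℚ_[p] F L :=
    .of_algebraMap_eq' (f.restrictScalars ℚ_[p]).comp_algebraMap.symm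
  have : FiniteDimensional F L := FiniteDimensional.right K F L
  have hn := Module.finrank_mul_finrank K F L
  rw [← hn, mul_comm] at h
  rw [wildTerm_tower p K F L (lt_of_mul_lt_mul_right h (Nat.zero_le _)), ← hn]
  push_cast
  ring

variable (K) in
theorem wildTerm_self : wildTerm p K K = 0 := by
  have := charZero_of_algebra_padic p K
  obtain ⟨ϖ, hϖ⟩ := IsDiscreteValuationRing.exists_irreducible (ringOfInt p K)
  have h0 : (ϖ : K) ≠ 0 := fun h => hϖ.ne_zero (Subtype.ext h)
  have h1 : Module.finrank K K < p := by
    rw [Module.finrank_self]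
    exact (Fact.out : p.Prime).one_lt
  have hd := padicAbs_pow_discExponent p K hϖ (isDifferentGenerator_of_finrank_lt p K K h1 hϖ hϖ)
  have hf := padicAbs_irreducible_pow_finrank p K K hϖ hϖ
  have hinj := pow_right_injective₀ (padicAbs_pos p K h0) (padicAbs_irreducible_lt_one p K hϖ).ne
  have h2 : discExponent p K K = 0 := hinj (by
    simpa only [Algebra.algebraMap_self, RingHom.id_apply, div_self h0, map_one, one_pow,
      pow_zero] using hd)
  have h3 : Module.finrank K K = residueDegree p K K := hinj hf
  rw [wildTerm, h2, h3]
  simp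

instance finiteDimensional_adjoin (r : AlgebraicClosure K) : FiniteDimensional K K⟮r⟯ :=
  adjoin.finiteDimensional (Algebra.IsIntegral.isIntegral r)

instance finiteDimensional_padic_adjoin (r : AlgebraicClosure K) :
    FiniteDimensional ℚ_[p] K⟮r⟯ :=
  Module.Finite.trans K K⟮r⟯

/-- The term of `r` in the wild exponent, distributed evenly over the conjugates of `r`. -/
noncomputable def meanRootTerm (r : AlgebraicClosure K) : ℚ :=
  rootTerm p K r / Module.finrank K K⟮r⟯

theorem meanRootTerm_eq_of_algHom {r s : AlgebraicClosure K} (f : K⟮s⟯ →ₐ[K] K⟮r⟯)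
    (h : (conjugates r).card < p * (conjugates s).card) :
    meanRootTerm p r = meanRootTerm p s := by
  have := charZero_of_algebra_padic p K
  rw [card_conjugates, card_conjugates] at h
  have h1 : rootTerm p K r * Module.finrank K K⟮s⟯ = rootTerm p K s * Module.finrank K K⟮r⟯ :=
    wildTerm_of_algHom p f h
  have hr : (Module.finrank K K⟮r⟯ : ℚ) ≠ 0 := by exact_mod_cast Module.finrank_pos.ne'
  have hs : (Module.finrank K K⟮s⟯ : ℚ) ≠ 0 := by exact_mod_cast Module.finrank_pos.ne'
  rw [meanRootTerm, meanRootTerm, div_eq_div_iff hr hs]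
  exact_mod_cast h1

theorem meanRootTerm_eq_zero {r : AlgebraicClosure K} (h : (conjugates r).card < p) :
    meanRootTerm p r = 0 := by
  have := charZero_of_algebra_padic p K
  rw [card_conjugates] at h
  have h1 := wildTerm_of_algHom p (Algebra.ofId K K⟮r⟯) (by rwa [Module.finrank_self, mul_one])
  rw [wildTerm_self, Module.finrank_self, Nat.cast_one, mul_one, zero_mul] at h1
  have h2 : rootTerm p K r = 0 := h1
  rw [meanRootTerm, h2, Int.cast_zero, zero_div]

theorem meanRootTerm_algEquiv (σ : AlgebraicClosure K ≃ₐ[K] AlgebraicClosure K)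
    (r : AlgebraicClosure K) : meanRootTerm p (σ r) = meanRootTerm p r := by
  have := charZero_of_algebra_padic p K
  have hr : IsIntegral K r := Algebra.IsIntegral.isIntegral r
  have hm : minpoly K (σ r) = minpoly K r := minpoly.algEquiv_eq σ r
  have hc : conjugates (σ r) = conjugates r := by rw [conjugates, conjugates, hm]
  have hroot : AdjoinSimple.gen K (σ r) ∈ (minpoly K r).aroots K⟮σ r⟯ := by
    rw [mem_aroots, ← hm, ← minpoly_gen K (σ r)]
    exact ⟨minpoly.ne_zero (Algebra.IsIntegral.isIntegral _), minpoly.aeval _ _⟩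
  refine meanRootTerm_eq_of_algHom p ((algHomAdjoinIntegralEquiv K hr).symm ⟨_, hroot⟩) ?_
  rw [hc]
  refine lt_mul_of_one_lt_left ?_ (Fact.out : p.Prime).one_lt
  rw [card_conjugates]
  exact Module.finrank_pos

/-- The wild exponent as a sum over all roots with multiplicity, which replaces the sum over Galois
orbits: the orbit of `r` has `[K(r) : K]` elements. -/
theorem wildExponent_eq_sum_roots (g : K[X]) :
    (wildExponent p K g : ℚ) =
      ((g.map (algebraMap K (AlgebraicClosure K))).roots.map (meanRootTerm p)).sum := by
  classical
  have := charZero_of_algebra_padic p K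
  set G := g.map (algebraMap K (AlgebraicClosure K))
  let mk : AlgebraicClosure K → MulAction.orbitRel.Quotient
    (AlgebraicClosure K ≃ₐ[K] AlgebraicClosure K) (AlgebraicClosure K) := fun r => Quotient.mk _ r
  have hmk : ∀ x y, mk x = mk y ↔ x ∈ conjugates y := fun x y => by
    rw [mem_conjugates, Normal.minpoly_eq_iff_mem_orbit]
    exact Quotient.eq
  have horb : rootOrbits g = ↑(G.roots.toFinset.image mk) := by
    rw [Finset.coe_image]
    rfl
  rw [wildExponent, horb, finsum_mem_coe_finset, Int.cast_sum, Finset.sum_multiset_map_count]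
  refine Finset.sum_image' _ fun r hr => ?_
  obtain ⟨t, ht⟩ : ∃ t, Quotient.out (mk r) = t := ⟨_, rfl⟩
  rw [ht]
  have htr : mk t = mk r := by rw [← ht]; exact Quotient.out_eq _
  obtain ⟨σ, hσ⟩ := mem_conjugates_iff_exists.1 ((hmk r t).1 htr.symm)
  have hfil : {x ∈ G.roots.toFinset | mk x = mk r} = conjugates t := by
    ext x
    rw [Finset.mem_filter, ← htr, hmk, and_iff_right_iff_imp]
    intro hx
    obtain ⟨τ, rfl⟩ := mem_conjugates_iff_exists.1 hx
    rw [Multiset.mem_toFinset, ← Multiset.count_pos, count_roots] at hr ⊢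
    rw [rootMultiplicity_algEquiv]
    rwa [← hσ, rootMultiplicity_algEquiv] at hr
  rw [hfil, Finset.sum_congr rfl (g := fun _ => (G.rootMultiplicity t : ℚ) * meanRootTerm p t)]
  · rw [Finset.sum_const, card_conjugates, meanRootTerm, nsmul_eq_mul]
    have hn : (Module.finrank K K⟮t⟯ : ℚ) ≠ 0 := by exact_mod_cast Module.finrank_pos.ne'
    push_cast
    field_simp
    exact mul_comm _ _
  · intro x hx
    obtain ⟨τ, rfl⟩ := mem_conjugates_iff_exists.1 hx
    rw [count_roots, rootMultiplicity_algEquiv, meanRootTerm_algEquiv, nsmul_eq_mul]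

end MeanRootTerm

/-! ### Comparison of the roots of two polynomials -/

section Counting

variable {α β : Type*} (S : Finset β) (P : β → α → Prop) [∀ s, DecidablePred (P s)]

theorem sum_map_sum_ite (R : Multiset α) (c : β → ℚ) :
    (R.map fun r => ∑ s ∈ S, if P s r then c s else 0).sum =
      ∑ s ∈ S, (R.countP (P s) : ℚ) * c s := by
  induction R using Multiset.induction with
  | empty => simp
  | cons r R ih =>
    rw [Multiset.map_cons, Multiset.sum_cons, ih, ← Finset.sum_add_distrib]
    refine Finset.sum_congr rfl fun s _ => ?_
    rw [Multiset.countP_cons]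
    split_ifs <;> push_cast <;> ring

theorem card_eq_sum_countP [DecidablePred fun r => ∀ s ∈ S, ¬ P s r]
    (hP : ∀ r, ∀ s ∈ S, ∀ s' ∈ S, P s r → P s' r → s = s') (R : Multiset α) :
    R.card = ∑ s ∈ S, R.countP (P s) + R.countP fun r => ∀ s ∈ S, ¬ P s r := by
  induction R using Multiset.induction with
  | empty => simp
  | cons r R ih =>
    simp only [Multiset.card_cons, Multiset.countP_cons, Finset.sum_add_distrib]
    have h : (∑ s ∈ S, if P s r then 1 else 0) + (if ∀ s ∈ S, ¬ P s r then 1 else 0) = 1 := by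
      by_cases hr : ∀ s ∈ S, ¬ P s r
      · rw [if_pos hr, Finset.sum_eq_zero fun s hs => if_neg (hr s hs)]
      · rw [if_neg hr]
        push Not at hr
        obtain ⟨s, hs, hsr⟩ := hr
        rw [Finset.sum_eq_single_of_mem s hs fun s' hs' hne =>
          if_neg fun h => hne (hP r s' hs' s hs h hsr), if_pos hsr]
    omega

end Counting

section

variable (p : ℕ) [Fact p.Prime] {K : Type*} [Field K] [Algebra ℚ_[p] K] [FiniteDimensional ℚ_[p] K]

theorem padicAbs_algEquiv_sub (σ : AlgebraicClosure K ≃ₐ[K] AlgebraicClosure K)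
    (x y : AlgebraicClosure K) :
    padicAbs p (AlgebraicClosure K) (σ x - σ y) = padicAbs p (AlgebraicClosure K) (x - y) := by
  rw [← map_sub]
  exact padicAbs_algHom p (σ.toAlgHom.restrictScalars ℚ_[p]) (x - y)

/-- Krasner's lemma. -/
theorem mem_adjoin_of_padicAbs_le {ρ : NNReal} {r s : AlgebraicClosure K}
    (hs : ∀ s' ∈ conjugates s, s' ≠ s → ρ < padicAbs p (AlgebraicClosure K) (s' - s))
    (hr : padicAbs p (AlgebraicClosure K) (r - s) ≤ ρ) : s ∈ K⟮r⟯ := by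
  have := charZero_of_algebra_padic p K
  rw [← InfiniteGalois.fixedField_fixingSubgroup K⟮r⟯, mem_fixedField_iff]
  intro σ hσ
  have hσr : σ r = r := (mem_fixingSubgroup_iff _ _).1 hσ r (mem_adjoin_simple_self K r)
  by_contra hne
  refine (hs _ (mem_conjugates_iff_exists.2 ⟨σ, rfl⟩) hne).not_ge ?_
  have h : σ s - s = (r - s) - (σ r - σ s) := by rw [hσr]; ring
  rw [h]
  refine (Valuation.map_sub _ _ _).trans (max_le hr ?_)
  rwa [padicAbs_algEquiv_sub]

theorem algEquiv_mem_roots (h : K[X])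
    (σ : AlgebraicClosure K ≃ₐ[K] AlgebraicClosure K) {r : AlgebraicClosure K}
    (hr : r ∈ (h.map (algebraMap K (AlgebraicClosure K))).roots) :
    σ r ∈ (h.map (algebraMap K (AlgebraicClosure K))).roots := by
  classical
  rw [← Multiset.count_pos, count_roots] at hr ⊢
  rwa [rootMultiplicity_algEquiv]

open Classical in
/-- If the roots of `h` are distributed among small discs around the roots of `g` in the same
numbers as the roots of `g`, up to fewer than `p` further roots, and all the multiplicities of `g`
are smaller than `p`, then the wild exponents agree. -/
theorem wildExponent_eq_of_countP_eq {g h : K[X]} {ρ : NNReal}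
    (hρ : ∀ s ∈ (g.map (algebraMap K (AlgebraicClosure K))).roots,
      ∀ s' ∈ (g.map (algebraMap K (AlgebraicClosure K))).roots,
      s' ≠ s → ρ < padicAbs p (AlgebraicClosure K) (s' - s))
    (hmul : ∀ s, (g.map (algebraMap K (AlgebraicClosure K))).roots.count s < p)
    (hdeg : h.natDegree < g.natDegree + p)
    (hcount : ∀ s ∈ (g.map (algebraMap K (AlgebraicClosure K))).roots,
      (h.map (algebraMap K (AlgebraicClosure K))).roots.countP
          (fun r => padicAbs p (AlgebraicClosure K) (r - s) ≤ ρ) =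
        (g.map (algebraMap K (AlgebraicClosure K))).roots.count s) :
    wildExponent p K h = wildExponent p K g := by
  have := charZero_of_algebra_padic p K
  have hcard : ∀ f : K[X], (f.map (algebraMap K (AlgebraicClosure K))).roots.card =
      f.natDegree := fun f => by
    rw [splits_iff_card_roots.1 (IsAlgClosed.splits (f.map _)), natDegree_map]
  have hGσ := fun σ r => algEquiv_mem_roots g σ (r := r)
  have hHσ := fun σ r => algEquiv_mem_roots h σ (r := r)
  have hGc := hcard g
  have hHc := hcard h
  rw [← Int.cast_inj (α := ℚ), wildExponent_eq_sum_roots p h, wildExponent_eq_sum_roots p g]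
  generalize (g.map (algebraMap K (AlgebraicClosure K))).roots = G at *
  generalize (h.map (algebraMap K (AlgebraicClosure K))).roots = H at *
  set S := G.toFinset
  have hS : ∀ s, s ∈ S ↔ s ∈ G := fun s => Multiset.mem_toFinset
  let near : AlgebraicClosure K → AlgebraicClosure K → Prop :=
    fun s r => padicAbs p (AlgebraicClosure K) (r - s) ≤ ρ
  have huniq : ∀ r, ∀ s ∈ S, ∀ s' ∈ S, near s r → near s' r → s = s' := by
    intro r s hs s' hs' h1 h2
    by_contra hne
    refine (hρ s' ((hS _).1 hs') s ((hS _).1 hs) hne).not_ge ?_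
    rw [← sub_sub_sub_cancel_left s' s r]
    exact (Valuation.map_sub _ _ _).trans (max_le h2 h1)
  have hrest : (H.countP fun r => ∀ s ∈ S, ¬ near s r) < p := by
    have h1 := card_eq_sum_countP S near huniq H
    rw [Finset.sum_congr rfl fun s hs => hcount s ((hS s).1 hs),
      Multiset.toFinset_sum_count_eq] at h1
    omega
  have key : ∀ r ∈ H, meanRootTerm p r = ∑ s ∈ S, if near s r then meanRootTerm p s else 0 := by
    intro r hr
    by_cases hn : ∀ s ∈ S, ¬ near s r
    · -- The roots far away from those of `g` are permuted by the Galois group.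
      rw [Finset.sum_eq_zero fun s hs => if_neg (hn s hs)]
      refine meanRootTerm_eq_zero p (lt_of_le_of_lt ?_ hrest)
      rw [Multiset.countP_eq_card_filter]
      refine le_trans (Finset.card_le_card fun x hx => ?_) (Multiset.toFinset_card_le _)
      obtain ⟨σ, rfl⟩ := mem_conjugates_iff_exists.1 hx
      rw [Multiset.mem_toFinset, Multiset.mem_filter]
      refine ⟨hHσ σ r hr, fun s hs hsr => hn (σ.symm s) ?_ ?_⟩
      · exact (hS _).2 (hGσ _ _ ((hS _).1 hs))
      · have h2 := padicAbs_algEquiv_sub p σ r (σ.symm s)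
        rw [σ.apply_symm_apply] at h2
        exact h2.symm.le.trans hsr
    · push Not at hn
      obtain ⟨s, hs, hsr⟩ := hn
      rw [Finset.sum_eq_single_of_mem s hs fun s' hs' hne =>
          if_neg fun h => hne (huniq r s' hs' s hs h hsr), if_pos hsr]
      have hconj : ∀ s' ∈ conjugates s, s' ∈ G := fun s' hs' => by
        obtain ⟨σ, rfl⟩ := mem_conjugates_iff_exists.1 hs'
        exact hGσ _ _ ((hS _).1 hs)
      have hmem : s ∈ K⟮r⟯ :=
        mem_adjoin_of_padicAbs_le p (fun s' hs' => hρ s ((hS _).1 hs) s' (hconj s' hs')) hsr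
      refine meanRootTerm_eq_of_algHom p (inclusion (adjoin_simple_le_iff.2 hmem)) ?_
      -- Each conjugate of `r` lies close to a conjugate of `s`, and there are fewer than `p` roots
      -- of `h` close to any of these.
      have hsub : conjugates r ⊆
          (conjugates s).biUnion fun s' => (H.filter (near s')).toFinset := fun x hx => by
        obtain ⟨σ, rfl⟩ := mem_conjugates_iff_exists.1 hx
        refine Finset.mem_biUnion.2 ⟨σ s, mem_conjugates_iff_exists.2 ⟨σ, rfl⟩, ?_⟩
        rw [Multiset.mem_toFinset, Multiset.mem_filter]
        exact ⟨hHσ σ r hr, (padicAbs_algEquiv_sub p σ r s).le.trans hsr⟩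
      have hne : (conjugates s).Nonempty := ⟨s, mem_conjugates.2 rfl⟩
      calc (conjugates r).card
          ≤ ∑ s' ∈ conjugates s, ((H.filter (near s')).toFinset).card :=
            (Finset.card_le_card hsub).trans Finset.card_biUnion_le
        _ < ∑ _s' ∈ conjugates s, p := by
            refine Finset.sum_lt_sum_of_nonempty hne fun s' hs' => ?_
            refine (Multiset.toFinset_card_le _).trans_lt ?_
            rw [← Multiset.countP_eq_card_filter]
            exact (hcount s' (hconj s' hs')).trans_lt (hmul s')
        _ = p * (conjugates s).card := by rw [Finset.sum_const, smul_eq_mul, mul_comm]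
  rw [Multiset.map_congr rfl key, sum_map_sum_ite, Finset.sum_multiset_map_count]
  refine Finset.sum_congr rfl fun s hs => ?_
  rw [nsmul_eq_mul]
  congr 2
  exact hcount s ((hS s).1 hs)

end

end WildExponent

theorem mainTheorem8 (p : ℕ) [Fact p.Prime] (K : Type*) [Field K] [Algebra ℚ_[p] K]
    [FiniteDimensional ℚ_[p] K] (g : Polynomial K) (hg : WildExponent.IsPowerFree p g) :
    ∃ ε : ℝ, 0 < ε ∧ ∀ h : Polynomial K, Squarefree h → h.natDegree < g.natDegree + p →
      (∀ i : ℕ, spectralNorm ℚ_[p] K (h.coeff i - g.coeff i) < ε) →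
      WildExponent.wildExponent p K h = WildExponent.wildExponent p K g := by
  classical
  have := WildExponent.charZero_of_algebra_padic p K
  have hg0 : g ≠ 0 := by
    rintro rfl
    exact not_isUnit_zero (hg 0 (dvd_zero _))
  set G := g.map (algebraMap K (AlgebraicClosure K)) with hG
  have hG0 : G ≠ 0 := (Polynomial.map_ne_zero_iff (algebraMap K _).injective).2 hg0
  obtain ⟨ρ, hρ0, hρ⟩ := WildExponent.exists_forall_mem_of_antitone G.roots.toFinset.offDiag
    (P := fun x ε => ε < WildExponent.padicAbs p (AlgebraicClosure K) (x.1 - x.2))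
    (fun x hx => exists_between (pos_iff_ne_zero.2 ((Valuation.ne_zero_iff _).2
      (sub_ne_zero.2 (Finset.mem_offDiag.1 hx).2.2)))) fun x ε ε' hle h => hle.trans_lt h
  have hρ' : ∀ s ∈ G.roots, ∀ s' ∈ G.roots, s' ≠ s →
      ρ < WildExponent.padicAbs p (AlgebraicClosure K) (s' - s) := fun s hs s' hs' hne =>
    hρ (s', s) (Finset.mem_offDiag.2
      ⟨Multiset.mem_toFinset.2 hs', Multiset.mem_toFinset.2 hs, hne⟩)
  obtain ⟨ε, hε0, hε⟩ := WildExponent.exists_countP_roots_eq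
    (WildExponent.padicAbs p (AlgebraicClosure K)) hρ0 hG0 G.roots.toFinset (g.natDegree + p)
    (by rw [hG, Polynomial.natDegree_map]; exact Nat.lt_add_of_pos_right (Fact.out : p.Prime).pos)
  refine ⟨ε, hε0, fun h hsq hdeg hclose => ?_⟩
  refine WildExponent.wildExponent_eq_of_countP_eq p hρ' (fun s => ?_) hdeg fun s hs => ?_
  · rw [Polynomial.count_roots]
    exact hg.rootMultiplicity_lt s
  · have h1 := hε (h.map (algebraMap K (AlgebraicClosure K)))
      ((Polynomial.map_ne_zero_iff (algebraMap K _).injective).2 hsq.ne_zero)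
      (by rwa [Polynomial.natDegree_map]) (fun i => by
        rw [hG, Polynomial.coeff_map, Polynomial.coeff_map, ← map_sub,
          WildExponent.padicAbs_algebraMap]
        exact hclose i) s (Multiset.mem_toFinset.2 hs)
    -- The disc of radius `ρ` around `s` contains no other root of `g`.
    refine h1.trans (Multiset.countP_congr rfl fun r hr => ?_)
    refine propext ⟨fun hle => ?_, fun heq => ?_⟩
    · by_contra hne
      exact (hρ' s hs r hr (Ne.symm hne)).not_ge hle
    · rw [heq, sub_self, map_zero]
      exact zero_le
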